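/- Let $N\ge 1$ and let $\Omega\subseteq\mathbb{R}^N$ be open and bounded, and write $\sigma(x)=\mathrm{dist}(x,\partial\Omega)$. Let $\rho\in C_c^\infty(\mathbb{R}^N)$ satisfy $0\le\rho\le 1$ and $\rho(x)=0\iff |x|\ge 1$, let $\rho$ be radially symmetric, and suppose $\rho(x)\ge\rho(y)$ whenever $|x|<\tfrac12$ and $|y|=\tfrac12$. Let $\eta\in C^\infty(\Omega)$ have bounded gradient on $\Omega$ and satisfy $\eta(x)\le\sigma(x)$ for all $x\in\Omega$, and suppose that for some $\kappa>0$ $$\kappa\,\sigma(x)^2\le\eta(x)\le\sigma(x)^2\qquad\text{for every }x\in\Omega.$$ For $f\in L^1(\Omega)$ and $x\in\Omega$ define $$Tf(x)=\Big(\int_{B_1(0)}\rho(y)\,dy\Big)^{-1}\int_{B_1(0)}\rho(z)\,f(x-\eta(x)z)\,dz .$$ Let $BV(\Omega)$ be the space of (classes of) functions $f\in L^1(\Omega)$ with $$|Df|(\Omega):=\sup\Big\{\int_\Omega f\,\mathrm{div}\,\phi\,dx:\ \phi\in C_c^\infty(\Omega;\mathbb{R}^N),\ \sup_x|\phi(x)|\le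 1\Big\}<\infty,$$ normed by $\|f\|_{BV(\Omega)}=\|f\|_{L^1(\Omega)}+|Df|(\Omega)$. Then $T$ is a well-defined bounded linear operator from $BV(\Omega)$ to $BV(\Omega)$. -/

import Mathlib

open MeasureTheory
open scoped ContDiff ENNReal

noncomputable section

namespace VariableStep

/-- Euclidean space of dimension `N`. -/
abbrev Eucl (N : ℕ) : Type := EuclideanSpace ℝ (Fin N)

/-- The distance of `x` to the boundary of `Ω`. -/
def bdryDist {N : ℕ} (Ω : Set (Eucl N)) (x : Eucl N) : ℝ :=
  Metric.infDist x (frontier Ω)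

/-- The (unnormalised) mollifying kernels: smooth, with values in `[0, 1]`, vanishing exactly
outside the open unit ball, radially symmetric, and on the ball of radius `1/2` at least as large
as on the sphere of radius `1/2`. -/
structure IsMollifierKernel {N : ℕ} (ρ : Eucl N → ℝ) : Prop where
  smooth : ContDiff ℝ ∞ ρ
  nonneg : ∀ x, 0 ≤ ρ x
  le_one : ∀ x, ρ x ≤ 1
  eq_zero_iff : ∀ x, ρ x = 0 ↔ 1 ≤ ‖x‖
  radial : ∀ x y, ‖x‖ = ‖y‖ → ρ x = ρ y
  ge_half : ∀ x y, ‖x‖ < 1 / 2 → ‖y‖ = 1 / 2 → ρ y ≤ ρ x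

/-- The variable step mollifier
`Tf(x) = (∫_{B_1(0)} ρ(y) dy)⁻¹ ∫_{B_1(0)} ρ(z) f(x - η(x) z) dz`. -/
def mollify {N : ℕ} (ρ η : Eucl N → ℝ) (f : Eucl N → ℝ) (x : Eucl N) : ℝ :=
  (∫ y in Metric.ball (0 : Eucl N) 1, ρ y)⁻¹ *
    ∫ z in Metric.ball (0 : Eucl N) 1, ρ z * f (x - η x • z)

/-- The divergence of a vector field. -/
def divergence {N : ℕ} (φ : Eucl N → Eucl N) (x : Eucl N) : ℝ :=
  ∑ i : Fin N, (fderiv ℝ φ x (EuclideanSpace.single i 1)) i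

/-- Smooth vector fields, compactly supported in `Ω`, with Euclidean norm at most one everywhere. -/
structure IsTestField {N : ℕ} (Ω : Set (Eucl N)) (φ : Eucl N → Eucl N) : Prop where
  smooth : ContDiff ℝ ∞ φ
  compact : HasCompactSupport φ
  supp : tsupport φ ⊆ Ω
  norm_le : ∀ x, ‖φ x‖ ≤ 1

/-- The total variation `V(u, Ω) = sup ∫_Ω u div φ dx`, the supremum over all test fields. The set
of test fields is symmetric, so passing to positive parts does not change the supremum. -/
def variation {N : ℕ} (Ω : Set (Eucl N)) (u : Eucl N → ℝ) : ℝ≥0∞ :=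
  ⨆ (φ : Eucl N → Eucl N) (_ : IsTestField Ω φ),
    ENNReal.ofReal (∫ x in Ω, u x * divergence φ x)

section Helpers

variable {N : ℕ} {Ω : Set (Eucl N)}

theorem variation_congr {u v : Eucl N → ℝ} (h : u =ᵐ[volume.restrict Ω] v) :
    variation Ω u = variation Ω v := by
  unfold variation
  refine iSup_congr fun φ => iSup_congr fun _ => ?_
  congr 1
  refine integral_congr_ae ?_
  filter_upwards [h] with x hx
  rw [hx]

theorem continuous_divergence {φ : Eucl N → Eucl N} (h : IsTestField Ω φ) :
    Continuous (divergence φ) := by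
  have h1 : Continuous (fderiv ℝ φ) := h.smooth.continuous_fderiv (by simp)
  unfold divergence
  fun_prop

theorem exists_bound_divergence {φ : Eucl N → Eucl N} (h : IsTestField Ω φ) :
    ∃ C, ∀ x, ‖divergence φ x‖ ≤ C := by
  refine (continuous_divergence h).bounded_above_of_compact_support ?_
  refine (h.compact.fderiv (𝕜 := ℝ)).mono' ?_
  refine subset_trans ?_ (subset_tsupport _)
  intro x hx
  contrapose! hx
  have : fderiv ℝ φ x = 0 := by simpa using hx
  simp [divergence, this]

theorem integrable_mul_divergence {u : Eucl N → ℝ} (hu : Integrable u (volume.restrict Ω))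
    {φ : Eucl N → Eucl N} (h : IsTestField Ω φ) :
    Integrable (fun x => u x * divergence φ x) (volume.restrict Ω) := by
  obtain ⟨C, hC⟩ := exists_bound_divergence h
  exact hu.mul_bdd (continuous_divergence h).aestronglyMeasurable (Filter.Eventually.of_forall hC)

theorem variation_zero : variation Ω (fun _ => (0 : ℝ)) = 0 := by
  simp [variation]

theorem variation_add_le {u v : Eucl N → ℝ} (hu : Integrable u (volume.restrict Ω))
    (hv : Integrable v (volume.restrict Ω)) :
    variation Ω (fun x => u x + v x) ≤ variation Ω u + variation Ω v := by
  refine iSup₂_le fun φ hφ => ?_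
  simp_rw [add_mul]
  rw [integral_add (integrable_mul_divergence hu hφ) (integrable_mul_divergence hv hφ)]
  refine ENNReal.ofReal_add_le.trans (add_le_add ?_ ?_)
  · exact le_iSup₂ (f := fun (φ : Eucl N → Eucl N) (_ : IsTestField Ω φ) =>
      ENNReal.ofReal (∫ x in Ω, u x * divergence φ x)) φ hφ
  · exact le_iSup₂ (f := fun (φ : Eucl N → Eucl N) (_ : IsTestField Ω φ) =>
      ENNReal.ofReal (∫ x in Ω, v x * divergence φ x)) φ hφ

theorem IsTestField.neg {φ : Eucl N → Eucl N} (h : IsTestField Ω φ) :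
    IsTestField Ω (fun x => -φ x) where
  smooth := h.smooth.neg
  compact := h.compact.neg
  supp := by
    have : tsupport (fun x => -φ x) = tsupport φ := by
      unfold tsupport
      congr 1
      ext x
      simp
    rw [this]
    exact h.supp
  norm_le x := by simpa using h.norm_le x

theorem divergence_neg (φ : Eucl N → Eucl N) (x : Eucl N) :
    divergence (fun x => -φ x) x = -divergence φ x := by
  simp [divergence, fderiv_fun_neg]

theorem variation_smul_le (c : ℝ) (u : Eucl N → ℝ) :
    variation Ω (fun x => c * u x) ≤ ENNReal.ofReal |c| * variation Ω u := by
  refine iSup₂_le fun φ hφ => ?_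
  simp_rw [mul_assoc]
  rw [integral_const_mul]
  rcases le_total 0 c with hc | hc
  · rw [abs_of_nonneg hc, ENNReal.ofReal_mul hc]
    gcongr
    exact le_iSup₂ (f := fun (φ : Eucl N → Eucl N) (_ : IsTestField Ω φ) =>
      ENNReal.ofReal (∫ x in Ω, u x * divergence φ x)) φ hφ
  · have h1 : c * ∫ x in Ω, u x * divergence φ x
        = (-c) * ∫ x in Ω, u x * divergence (fun y => -φ y) x := by
      simp_rw [divergence_neg, mul_neg]
      rw [integral_neg]
      ring
    rw [abs_of_nonpos hc, h1, ENNReal.ofReal_mul (neg_nonneg.2 hc)]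
    gcongr
    exact le_iSup₂ (f := fun (φ : Eucl N → Eucl N) (_ : IsTestField Ω φ) =>
      ENNReal.ofReal (∫ x in Ω, u x * divergence φ x)) _ hφ.neg

theorem variation_smul (c : ℝ) (u : Eucl N → ℝ) :
    variation Ω (fun x => c * u x) = ENNReal.ofReal |c| * variation Ω u := by
  refine le_antisymm (variation_smul_le c u) ?_
  rcases eq_or_ne c 0 with rfl | hc
  · simp
  have h := variation_smul_le (Ω := Ω) c⁻¹ (fun x => c * u x)
  simp_rw [inv_mul_cancel_left₀ hc] at h
  calc ENNReal.ofReal |c| * variation Ω u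
      ≤ ENNReal.ofReal |c| * (ENNReal.ofReal |c⁻¹| * variation Ω (fun x => c * u x)) := by gcongr
    _ = variation Ω (fun x => c * u x) := by
        rw [← mul_assoc, ← ENNReal.ofReal_mul (abs_nonneg c), ← abs_mul, mul_inv_cancel₀ hc]
        simp

theorem variation_Lp_add_le (f g : Lp ℝ 1 (volume.restrict Ω)) :
    variation Ω (f + g : Lp ℝ 1 (volume.restrict Ω)) ≤ variation Ω f + variation Ω g := by
  rw [variation_congr (Lp.coeFn_add f g)]
  exact variation_add_le (L1.integrable_coeFn f) (L1.integrable_coeFn g)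

theorem variation_Lp_smul (c : ℝ) (f : Lp ℝ 1 (volume.restrict Ω)) :
    variation Ω (c • f : Lp ℝ 1 (volume.restrict Ω)) = ENNReal.ofReal |c| * variation Ω f := by
  rw [variation_congr (Lp.coeFn_smul c f)]
  exact variation_smul c f

theorem variation_Lp_zero : variation Ω (0 : Lp ℝ 1 (volume.restrict Ω)) = 0 := by
  rw [variation_congr (Lp.coeFn_zero ℝ 1 (volume.restrict Ω))]
  exact variation_zero

end Helpers

/-- The classes in `L¹(Ω)` of finite total variation, as a linear subspace. -/
def bvSubmodule {N : ℕ} (Ω : Set (Eucl N)) : Submodule ℝ (Lp ℝ 1 (volume.restrict Ω)) where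
  carrier := {f | variation Ω f < ⊤}
  zero_mem' := by
    change variation Ω (0 : Lp ℝ 1 (volume.restrict Ω)) < ⊤
    rw [variation_Lp_zero]
    exact ENNReal.zero_lt_top
  add_mem' := fun {f g} hf hg =>
    (variation_Lp_add_le f g).trans_lt (ENNReal.add_lt_top.2 ⟨hf, hg⟩)
  smul_mem' := fun c f hf => by
    change variation Ω (c • f : Lp ℝ 1 (volume.restrict Ω)) < ⊤
    rw [variation_Lp_smul]
    exact ENNReal.mul_lt_top ENNReal.ofReal_lt_top hf

/-- The space `BV(Ω)`. It is a type of its own, and not the subspace `bvSubmodule Ω`, because it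
carries its own norm and not the one of `L¹(Ω)`. -/
def BV {N : ℕ} (Ω : Set (Eucl N)) : Type := bvSubmodule Ω

namespace BV

variable {N : ℕ} {Ω : Set (Eucl N)}

instance : AddCommGroup (BV Ω) := inferInstanceAs (AddCommGroup (bvSubmodule Ω))

instance : Module ℝ (BV Ω) := inferInstanceAs (Module ℝ (bvSubmodule Ω))

/-- The inclusion of `BV(Ω)` into `L¹(Ω)`. -/
def toL1 : BV Ω →ₗ[ℝ] Lp ℝ 1 (volume.restrict Ω) := (bvSubmodule Ω).subtype

theorem variation_lt_top (f : BV Ω) : variation Ω (toL1 f) < ⊤ := Subtype.property f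

theorem toL1_injective : Function.Injective (toL1 (Ω := Ω)) := Subtype.val_injective

/-- The norm `‖f‖_{L¹(Ω)} + |Df|(Ω)`. -/
instance : Norm (BV Ω) where
  norm f := ‖toL1 f‖ + (variation Ω (toL1 f)).toReal

theorem norm_def (f : BV Ω) : ‖f‖ = ‖toL1 f‖ + (variation Ω (toL1 f)).toReal := rfl

theorem normedSpaceCore : NormedSpace.Core ℝ (BV Ω) where
  norm_nonneg f := by
    rw [norm_def]
    positivity
  norm_smul c f := by
    rw [norm_def, norm_def, map_smul, norm_smul, variation_Lp_smul, ENNReal.toReal_mul,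
      ENNReal.toReal_ofReal (abs_nonneg c), Real.norm_eq_abs]
    ring
  norm_triangle f g := by
    rw [norm_def, norm_def, norm_def, map_add]
    have h1 := norm_add_le (toL1 f) (toL1 g)
    have h2 : (variation Ω (toL1 f + toL1 g : Lp ℝ 1 (volume.restrict Ω))).toReal
        ≤ (variation Ω (toL1 f)).toReal + (variation Ω (toL1 g)).toReal := by
      rw [← ENNReal.toReal_add (variation_lt_top f).ne (variation_lt_top g).ne]
      exact ENNReal.toReal_mono
        (ENNReal.add_lt_top.2 ⟨variation_lt_top f, variation_lt_top g⟩).ne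
        (variation_Lp_add_le _ _)
    linarith
  norm_eq_zero_iff f := by
    constructor
    · intro h
      rw [norm_def] at h
      have h1 : ‖toL1 f‖ = 0 :=
        le_antisymm (by linarith [ENNReal.toReal_nonneg (a := variation Ω (toL1 f))])
          (norm_nonneg _)
      exact toL1_injective (by rw [norm_eq_zero.1 h1, map_zero])
    · rintro rfl
      rw [norm_def, map_zero, variation_Lp_zero]
      simp

instance : NormedAddCommGroup (BV Ω) := NormedAddCommGroup.ofCore normedSpaceCore

instance : NormedSpace ℝ (BV Ω) := NormedSpace.ofCore normedSpaceCore

end BV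

end VariableStep

end

/-! ### Divergence calculus for compactly supported fields. -/

namespace VariableStep

variable {N : ℕ}

/-! Since `η ≤ σ` keeps the averaging balls inside Ω, a change of variables makes `T` an integral
operator on Ω with kernel k(x,y) = η(x)^{-N} ρ((x-y)/η(x)), up to the normalising constant.

The L¹ bound is the easy half of Schur's test: it suffices that ∫_Ω k(x,y) dx ≤ M for all y
(`exists_lintegral_kern_le`). On the support of k one has |x-y| < η(x) ≤ σ(x)². If σ(x) ≤ 1/2, then
σ(x) and σ(y) are comparable, so k is at most of order σ(y)^{-2N} and lives on a ball around y of
radius of order σ(y)², and the powers cancel. If σ(x) > 1/2, then η is bounded below, k is bounded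
and Ω has finite volume.

For the variation, move `T` onto div φ by Fubini. The identity div_x(kφ) = k div φ - div_y W, with W
= k(x,y) (φ(x) - η(x)⁻¹ Dη(x)[φ(x)] (x-y)), integrates in x to ∫ k div φ dx = div Ψ, where Ψ(y) = ∫
W dx (`divergence_kern_smul`, `divergence_integral_dualField`). As |x-y| ≤ η(x) on the support, |Ψ|
≤ (1+G)M, where G bounds the gradient of η.

One obstacle remains: η may equal σ somewhere, so the support of Ψ may touch ∂Ω. Dividing the steps
by u > 1 makes it compact in Ω; the bounds are uniform for 1 ≤ u ≤ 2, and u → 1 by dominated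
convergence (`ofReal_integral_adjoint_divergence_le`). -/

theorem divergence_smul {u : Eucl N → ℝ} {V : Eucl N → Eucl N} {x : Eucl N}
    (hu : DifferentiableAt ℝ u x) (hV : DifferentiableAt ℝ V x) :
    divergence (fun y => u y • V y) x = u x * divergence V x + fderiv ℝ u x (V x) := by
  have h : fderiv ℝ u x (V x) = ∑ i, fderiv ℝ u x (EuclideanSpace.single i 1) * V x i := by
    conv_lhs => rw [← (EuclideanSpace.basisFun (Fin N) ℝ).sum_repr (V x)]
    simp [mul_comm]
  rw [h]
  simp only [divergence, fderiv_fun_smul hu hV]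
  simp [Finset.sum_add_distrib, Finset.mul_sum]

theorem divergence_const_smul_apply (c : ℝ) {V : Eucl N → Eucl N} {x : Eucl N}
    (hV : DifferentiableAt ℝ V x) :
    divergence (fun y => c • V y) x = c * divergence V x := by
  rw [divergence_smul (differentiableAt_const c) hV]
  simp

/-- The affine field `y ↦ a + s • (x - y)` has divergence `-N s`. -/
theorem divergence_affine (a x y : Eucl N) (s : ℝ) :
    divergence (fun y => a + s • (x - y)) y = -(N * s) := by
  have h : HasFDerivAt (fun y : Eucl N => a + s • (x - y))
      (s • (-ContinuousLinearMap.id ℝ (Eucl N))) y :=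
    (((hasFDerivAt_id y).const_sub x).const_smul s).const_add a
  simp [divergence, h.fderiv]

theorem integral_divergence_eq_zero {V : Eucl N → Eucl N} (hV : ContDiff ℝ ∞ V)
    (hc : HasCompactSupport V) : ∫ x, divergence V x = 0 := by
  have hd : Differentiable ℝ V := hV.differentiable (by simp)
  have hcd : Continuous (fderiv ℝ V) := hV.continuous_fderiv (by simp)
  have hcomp (i : Fin N) (x : Eucl N) :
      fderiv ℝ (fun y => V y i) x = (EuclideanSpace.proj i).comp (fderiv ℝ V x) :=
    ((EuclideanSpace.proj i : Eucl N →L[ℝ] ℝ).hasFDerivAt.comp x (hd x).hasFDerivAt).fderiv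
  have hcs (i : Fin N) : HasCompactSupport fun x => fderiv ℝ V x (EuclideanSpace.single i 1) i :=
    (hc.fderiv (𝕜 := ℝ)).comp_left
      (g := fun L : Eucl N →L[ℝ] Eucl N => L (EuclideanSpace.single i 1) i) (by simp)
  have hint (i : Fin N) : Integrable fun x => fderiv ℝ V x (EuclideanSpace.single i 1) i :=
    Continuous.integrable_of_hasCompactSupport (by fun_prop) (hcs i)
  unfold divergence
  rw [integral_finsetSum _ fun i _ => hint i]
  refine Finset.sum_eq_zero fun i _ => ?_
  have hVi : Integrable fun x => V x i :=
    Continuous.integrable_of_hasCompactSupport (by have := hV.continuous; fun_prop)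
      (hc.comp_left (g := fun v : Eucl N => v i) (by simp))
  -- Integration by parts against the constant 1, whose derivative vanishes.
  have h := integral_mul_fderiv_eq_neg_fderiv_mul_of_integrable (𝕜 := ℝ) (μ := volume)
    (f := fun _ : Eucl N => (1 : ℝ)) (g := fun x => V x i) (v := EuclideanSpace.single i 1)
    (by simp) (by simpa [hcomp] using hint i) (by simpa using hVi)
    (fun x _ => differentiableAt_const _) (fun x _ => by fun_prop)
  simpa [hcomp] using h

/-! ### Differentiation of vector-valued integrals in a parameter. -/

section Parametric

variable {V : Eucl N → Eucl N → Eucl N} {K : Set (Eucl N)}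

/-- The integral is a convolution with the constant 1, evaluated at 0. The reflection of x below
undoes the one in the convolution, and smoothness in the parameter is then inherited. -/
theorem contDiff_integral_param (hV : ContDiff ℝ ∞ (Function.uncurry V)) (hK : IsCompact K)
    (h0 : ∀ x, x ∉ K → ∀ y, V x y = 0) : ContDiff ℝ ∞ fun y => ∫ x, V x y := by
  have h := contDiffOn_convolution_right_with_param (𝕜 := ℝ) (n := ⊤) (μ := volume)
    (f := fun _ : Eucl N => (1 : ℝ)) (ContinuousLinearMap.lsmul ℝ ℝ)
    (g := fun y x => V (-x) y) (s := Set.univ) (k := -K) isOpen_univ hK.neg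
    (fun y x _ hx => h0 _ (by simpa using hx) y) (by exact locallyIntegrable_const 1)
    (by
      have : ContDiff ℝ ∞ fun p : Eucl N × Eucl N => Function.uncurry V (-p.2, p.1) :=
        hV.comp (contDiff_snd.neg.prodMk contDiff_fst)
      exact this.contDiffOn)
  rw [Set.univ_prod_univ, contDiffOn_univ] at h
  have h2 := h.comp (contDiff_id.prodMk (contDiff_const (c := (0 : Eucl N))))
  simpa [convolution, Function.comp_def] using h2

theorem hasFDerivAt_integral_param (hV : ContDiff ℝ ∞ (Function.uncurry V)) (hK : IsCompact K)
    (h0 : ∀ x, x ∉ K → ∀ y, V x y = 0) (y : Eucl N) :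
    Integrable (fun x => fderiv ℝ (V x) y) ∧
    HasFDerivAt (fun y => ∫ x, V x y) (∫ x, fderiv ℝ (V x) y) y := by
  have hc (y : Eucl N) : Continuous fun x => V x y :=
    hV.continuous.comp (continuous_id.prodMk continuous_const)
  have hsm (x : Eucl N) : ContDiff ℝ ∞ (V x) :=
    hV.comp (contDiff_const.prodMk contDiff_id)
  have hcf : Continuous fun p : Eucl N × Eucl N => fderiv ℝ (V p.1) p.2 := by
    have : ContDiff ℝ 1 (Function.uncurry V) := hV.of_le (by simp)
    exact (ContDiff.fderiv (m := 1) (n := 0) (f := fun p : Eucl N × Eucl N => V p.1)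
      (by
        have h1 : ContDiff ℝ 1 fun r : (Eucl N × Eucl N) × Eucl N =>
          Function.uncurry V (r.1.1, r.2) :=
            this.comp ((contDiff_fst.comp contDiff_fst).prodMk contDiff_snd)
        exact h1) contDiff_snd (by simp)).continuous
  have hf0 (x : Eucl N) (hx : x ∉ K) (y : Eucl N) : fderiv ℝ (V x) y = 0 := by
    have : V x = fun _ => 0 := funext (h0 x hx)
    simp [this]
  have hcs {F : Type} [NormedAddCommGroup F] {f : Eucl N → F} (hf : ∀ x, x ∉ K → f x = 0) :
      HasCompactSupport f := HasCompactSupport.intro hK hf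
  -- The dominating function is a constant on K, valid for parameters in the unit ball around y.
  obtain ⟨C, hC⟩ := (hK.prod (isCompact_closedBall y 1)).exists_bound_of_continuousOn
    hcf.continuousOn
  have hmeas : AEStronglyMeasurable (fun x => fderiv ℝ (V x) y) volume :=
    Continuous.aestronglyMeasurable (hcf.comp (continuous_id.prodMk continuous_const))
  refine ⟨Continuous.integrable_of_hasCompactSupport
    (hcf.comp (continuous_id.prodMk continuous_const)) (hcs fun x hx => hf0 x hx y), ?_⟩
  refine hasFDerivAt_integral_of_dominated_of_fderiv_le (𝕜 := ℝ)
    (F := fun y x => V x y) (F' := fun y x => fderiv ℝ (V x) y) (bound := K.indicator fun _ => C)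
    (Metric.ball_mem_nhds y one_pos) (Filter.Eventually.of_forall fun y =>
      (hc y).aestronglyMeasurable)
    (Continuous.integrable_of_hasCompactSupport (hc y) (hcs fun x hx => h0 x hx y)) hmeas
    (Filter.Eventually.of_forall fun x z hz => ?_) ?_
    (Filter.Eventually.of_forall fun x z _ => ((hsm x).differentiable (by simp) z).hasFDerivAt)
  · by_cases hx : x ∈ K
    · rw [Set.indicator_of_mem hx]
      exact hC (x, z) ⟨hx, Metric.ball_subset_closedBall hz⟩
    · rw [Set.indicator_of_notMem hx, hf0 x hx, norm_zero]
  · exact (integrable_indicator_iff hK.measurableSet).2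
      (integrableOn_const hK.measure_lt_top.ne)

theorem divergence_integral_param (hV : ContDiff ℝ ∞ (Function.uncurry V)) (hK : IsCompact K)
    (h0 : ∀ x, x ∉ K → ∀ y, V x y = 0) (y : Eucl N) :
    Integrable (fun x => divergence (V x) y) ∧
    divergence (fun y => ∫ x, V x y) y = ∫ x, divergence (V x) y := by
  obtain ⟨hi, hd⟩ := hasFDerivAt_integral_param hV hK h0 y
  have hL (i : Fin N) : Integrable fun x => fderiv ℝ (V x) y (EuclideanSpace.single i 1) i :=
    (((EuclideanSpace.proj i : Eucl N →L[ℝ] ℝ).comp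
      (ContinuousLinearMap.apply ℝ (Eucl N) (EuclideanSpace.single i 1))).integrable_comp hi)
  refine ⟨integrable_finsetSum _ fun i _ => hL i, ?_⟩
  unfold divergence
  rw [integral_finsetSum _ fun i _ => hL i, hd.fderiv]
  refine Finset.sum_congr rfl fun i _ => ?_
  exact (((EuclideanSpace.proj i : Eucl N →L[ℝ] ℝ).comp
    (ContinuousLinearMap.apply ℝ (Eucl N) (EuclideanSpace.single i 1))).integral_comp_comm hi).symm

end Parametric

/-! ### The kernel, its dual field and the divergence identity. -/

/-- The kernel `q(x)^N ρ(q(x) (x - y))`, for a reciprocal step size `q`. -/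
noncomputable def kern (ρ q : Eucl N → ℝ) (x y : Eucl N) : ℝ :=
  q x ^ N * ρ (q x • (x - y))

/-- The field whose divergence in `y` integrates to the adjoint mollification of `div φ`. -/
noncomputable def dualField (ρ q : Eucl N → ℝ) (φ : Eucl N → Eucl N) (x y : Eucl N) : Eucl N :=
  (q x ^ (N - 1) * ρ (q x • (x - y))) • (q x • φ x + fderiv ℝ q x (φ x) • (x - y))

theorem contDiff_uncurry_dualField {ρ q : Eucl N → ℝ} {φ : Eucl N → Eucl N}
    (hρ : ContDiff ℝ ∞ ρ) (hq : ContDiff ℝ ∞ q) (hφ : ContDiff ℝ ∞ φ) :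
    ContDiff ℝ ∞ (Function.uncurry (dualField ρ q φ)) := by
  have hq' : ContDiff ℝ ∞ (fderiv ℝ q) := hq.fderiv_right (by simp)
  have h1 : ContDiff ℝ ∞ fun p : Eucl N × Eucl N => q p.1 := hq.comp contDiff_fst
  have h2 : ContDiff ℝ ∞ fun p : Eucl N × Eucl N => φ p.1 := hφ.comp contDiff_fst
  have h3 : ContDiff ℝ ∞ fun p : Eucl N × Eucl N => fderiv ℝ q p.1 := hq'.comp contDiff_fst
  have h4 : ContDiff ℝ ∞ fun p : Eucl N × Eucl N => p.1 - p.2 := contDiff_fst.sub contDiff_snd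
  exact ((h1.pow _).mul (hρ.comp (h1.smul h4))).smul
    ((h1.smul h2).add ((h3.clm_apply h2).smul h4))

/-- The x-derivative of the kernel along φ is minus the y-divergence of the dual field: the
derivative of q^N matches the divergence -N Dq(φ) of the affine factor, and the derivatives of ρ
match by the chain rule. With q^(N-1) there is no division by q, which may vanish. -/
theorem divergence_kern_smul {ρ q : Eucl N → ℝ} {φ : Eucl N → Eucl N} (hN : 1 ≤ N)
    (hρ : ContDiff ℝ ∞ ρ) (hq : ContDiff ℝ ∞ q) (hφ : ContDiff ℝ ∞ φ) (x y : Eucl N) :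
    divergence (fun x => kern ρ q x y • φ x) x
      = kern ρ q x y * divergence φ x - divergence (dualField ρ q φ x) y := by
  have hdρ := (hρ.differentiable (by simp) (q x • (x - y))).hasFDerivAt
  have hdq := (hq.differentiable (by simp) x).hasFDerivAt
  have hk := (hdq.pow N).mul (hdρ.comp x (hdq.smul ((hasFDerivAt_id x).sub_const y)))
  have hw : HasFDerivAt (fun y : Eucl N => q x ^ (N - 1) * ρ (q x • (x - y))) _ y :=
    (hdρ.comp y (((hasFDerivAt_id y).const_sub x).const_smul (q x))).const_mul (q x ^ (N - 1))
  have e1 := divergence_smul (u := fun x => kern ρ q x y) (V := φ) hk.differentiableAt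
    (hφ.differentiable (by simp) x)
  have e2 := divergence_smul (u := fun y => q x ^ (N - 1) * ρ (q x • (x - y)))
    (V := fun y => q x • φ x + fderiv ℝ q x (φ x) • (x - y)) hw.differentiableAt
    (by fun_prop)
  rw [divergence_affine] at e2
  have e3 : fderiv ℝ (fun x => kern ρ q x y) x = _ := hk.fderiv
  rw [e1, show dualField ρ q φ x = fun y => (q x ^ (N - 1) * ρ (q x • (x - y))) •
    (q x • φ x + fderiv ℝ q x (φ x) • (x - y)) from rfl, e2, e3, hw.fderiv]
  obtain ⟨n, rfl⟩ := Nat.exists_eq_add_of_le' hN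
  simp
  ring

theorem divergence_integral_dualField {ρ q : Eucl N → ℝ} {φ : Eucl N → Eucl N} (hN : 1 ≤ N)
    (hρ : ContDiff ℝ ∞ ρ) (hq : ContDiff ℝ ∞ q) (hφ : ContDiff ℝ ∞ φ)
    (hc : HasCompactSupport φ) (y : Eucl N) :
    divergence (fun y => ∫ x, dualField ρ q φ x y) y = ∫ x, kern ρ q x y * divergence φ x := by
  have h0 (x : Eucl N) (hx : x ∉ tsupport φ) (y : Eucl N) : dualField ρ q φ x y = 0 := by
    simp [dualField, image_eq_zero_of_notMem_tsupport hx]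
  obtain ⟨hi, hd⟩ := divergence_integral_param (contDiff_uncurry_dualField hρ hq hφ) hc h0 y
  have hksm : ContDiff ℝ ∞ fun x => kern ρ q x y :=
    (hq.pow N).mul (hρ.comp (hq.smul (contDiff_id.sub contDiff_const)))
  have hV : ContDiff ℝ ∞ (fun x => kern ρ q x y • φ x) := hksm.smul hφ
  have hVc : HasCompactSupport (fun x => kern ρ q x y • φ x) :=
    HasCompactSupport.intro hc fun x hx => by simp [image_eq_zero_of_notMem_tsupport hx]
  have hi2 : Integrable fun x => divergence (fun x => kern ρ q x y • φ x) x := by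
    have hcd : Continuous (fderiv ℝ (fun x => kern ρ q x y • φ x)) :=
      hV.continuous_fderiv (by simp)
    refine Continuous.integrable_of_hasCompactSupport (by unfold divergence; fun_prop) ?_
    exact (hVc.fderiv (𝕜 := ℝ)).comp_left
      (g := fun L : Eucl N →L[ℝ] Eucl N => ∑ i, L (EuclideanSpace.single i 1) i) (by simp)
  -- The added zero is ∫ div_x(kφ) dx, which vanishes by compact support.
  rw [hd, ← add_zero (∫ x, divergence (dualField ρ q φ x) y), ←
    integral_divergence_eq_zero hV hVc, ← integral_add hi hi2]
  refine integral_congr_ae (Filter.Eventually.of_forall fun x => ?_)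
  simp only
  rw [divergence_kern_smul hN hρ hq hφ]
  ring

end VariableStep

/-! ### Boundary distance, the uniform kernel mass and the kernel form of the mollifier. -/

namespace VariableStep

variable {N : ℕ}

section Geometry

variable {Ω : Set (Eucl N)}

theorem ne_univ_of_isBounded (hN : 1 ≤ N) (hb : Bornology.IsBounded Ω) : Ω ≠ Set.univ := by
  rintro rfl
  have : Nonempty (Fin N) := ⟨⟨0, hN⟩⟩
  exact NormedSpace.unbounded_univ ℝ (Eucl N) hb

theorem bdryDist_pos (hN : 1 ≤ N) (ho : IsOpen Ω) (hb : Bornology.IsBounded Ω) {x : Eucl N}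
    (hx : x ∈ Ω) : 0 < bdryDist Ω x := by
  -- `Metric.infDist` to the empty set is 0, so the boundary has to be nonempty; this is where N ≥ 1
  -- and boundedness enter.
  have hne : (frontier Ω).Nonempty :=
    nonempty_frontier_iff.2 ⟨⟨x, hx⟩, ne_univ_of_isBounded hN hb⟩
  refine (isClosed_frontier.notMem_iff_infDist_pos hne).1 fun h => ?_
  exact (ho.inter_frontier_eq ▸ (⟨hx, h⟩ : x ∈ Ω ∩ frontier Ω) : x ∈ (∅ : Set (Eucl N)))

theorem ball_bdryDist_subset (hN : 1 ≤ N) (hb : Bornology.IsBounded Ω) {x : Eucl N}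
    (hx : x ∈ Ω) : Metric.ball x (bdryDist Ω x) ⊆ Ω := by
  obtain ⟨y, hy, hxy⟩ := exists_mem_frontier_infDist_compl_eq_dist hx (ne_univ_of_isBounded hN hb)
  refine (Metric.ball_subset_ball ?_).trans Metric.ball_infDist_compl_subset
  rw [hxy]
  exact Metric.infDist_le_dist_of_mem hy

end Geometry

/-- The mass in `x` of the kernel of the variable step mollifier is bounded uniformly in `y`, and
uniformly for steps shortened by a factor of at most two. -/
theorem exists_lintegral_kern_le {Ω : Set (Eucl N)} (hN : 1 ≤ N) (ho : IsOpen Ω)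
    (hb : Bornology.IsBounded Ω) {ρ : Eucl N → ℝ} (hρ : IsMollifierKernel ρ) {η : Eucl N → ℝ}
    {κ : ℝ} (hκ : 0 < κ) (hlow : ∀ x ∈ Ω, κ * bdryDist Ω x ^ 2 ≤ η x)
    (hupp : ∀ x ∈ Ω, η x ≤ bdryDist Ω x ^ 2) :
    ∃ M : ℝ, 0 < M ∧ ∀ u : ℝ, 1 ≤ u → u ≤ 2 → ∀ y : Eucl N,
      ∫⁻ x in Ω, ‖kern ρ (fun x => u * (η x)⁻¹) x y‖ₑ ≤ ENNReal.ofReal M := by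
  have : Nonempty (Fin N) := ⟨⟨0, hN⟩⟩
  set B : ℝ≥0∞ := volume (Metric.ball (0 : Eucl N) 1) with hB
  have hBtop : B ≠ ⊤ := measure_ball_lt_top.ne
  have hΩtop : volume Ω ≠ ⊤ := hb.measure_lt_top.ne
  refine ⟨(18 / κ) ^ N * B.toReal + (8 / κ) ^ N * (volume Ω).toReal + 1, by positivity,
    fun u hu1 hu2 y => ?_⟩
  have hs0 : 0 ≤ bdryDist Ω y := Metric.infDist_nonneg
  set s := bdryDist Ω y with hs
  -- Near the boundary s ≤ (3/2)σ(x), so 2/η(x) ≤ 2/(κσ(x)²) ≤ 18/(4κs²); the factor 2 bounds u. The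
  -- 4s² reappears as the radius of the ball, so that it cancels.
  set a : ℝ := (18 / (4 * κ * s ^ 2)) ^ N with ha
  have ha0 : 0 ≤ a := by positivity
  have hpt : ∀ x ∈ Ω, ‖kern ρ (fun x => u * (η x)⁻¹) x y‖ₑ
      ≤ (Metric.ball y (4 * s ^ 2)).indicator (fun _ => ENNReal.ofReal a) x
        + ENNReal.ofReal ((8 / κ) ^ N) := by
    intro x hx
    have hσ : 0 < bdryDist Ω x := bdryDist_pos hN ho hb hx
    have hl := hlow x hx
    have hup := hupp x hx
    have hη : 0 < η x := lt_of_lt_of_le (by positivity) hl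
    rcases le_or_gt (η x) ‖x - y‖ with hxy | hxy
    · have : ρ ((u * (η x)⁻¹) • (x - y)) = 0 := by
        rw [hρ.eq_zero_iff, norm_smul, Real.norm_of_nonneg (by positivity), mul_assoc]
        have : 1 ≤ (η x)⁻¹ * ‖x - y‖ := by
          rw [inv_mul_eq_div, one_le_div hη]
          exact hxy
        nlinarith
      simp [kern, this]
    have hk : ‖kern ρ (fun x => u * (η x)⁻¹) x y‖ ≤ (2 * (η x)⁻¹) ^ N := by
      rw [kern, norm_mul, Real.norm_of_nonneg (by positivity), Real.norm_of_nonneg (hρ.nonneg _)]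
      refine (mul_le_of_le_one_right (by positivity) (hρ.le_one _)).trans ?_
      gcongr
    rw [← ofReal_norm]
    -- Below 1/2, |x-y| < σ(x)² ≤ σ(x)/2, and σ being 1-Lipschitz gives σ(x) ≤ 2s and s ≤ (3/2)σ(x).
    -- Above 1/2, η(x) ≥ κ/4 gives the constant 8/κ.
    rcases le_or_gt (bdryDist Ω x) (1 / 2) with hx2 | hx2
    · have h1 : bdryDist Ω x ≤ s + ‖x - y‖ := by
        rw [← dist_eq_norm]
        exact Metric.infDist_le_infDist_add_dist
      have h2 : s ≤ bdryDist Ω x + ‖x - y‖ := by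
        rw [← dist_eq_norm, dist_comm]
        exact Metric.infDist_le_infDist_add_dist
      have h3 : bdryDist Ω x ≤ 2 * s := by nlinarith
      have h4 : s ≤ 3 / 2 * bdryDist Ω x := by nlinarith
      have hspos : 0 < s := by linarith
      have hmem : x ∈ Metric.ball y (4 * s ^ 2) := by
        rw [Metric.mem_ball, dist_eq_norm]
        nlinarith
      rw [Set.indicator_of_mem hmem]
      refine le_add_right (ENNReal.ofReal_le_ofReal (hk.trans ?_))
      refine pow_le_pow_left₀ (by positivity) ?_ N
      rw [← div_eq_mul_inv, div_le_div_iff₀ hη (by positivity)]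
      have : s ^ 2 ≤ 9 / 4 * bdryDist Ω x ^ 2 := by nlinarith
      nlinarith
    · refine le_add_left (ENNReal.ofReal_le_ofReal (hk.trans ?_))
      refine pow_le_pow_left₀ (by positivity) ?_ N
      rw [← div_eq_mul_inv, div_le_div_iff₀ hη hκ]
      have : 1 / 4 ≤ bdryDist Ω x ^ 2 := by nlinarith
      nlinarith
  have hball : ENNReal.ofReal a * volume (Metric.ball y (4 * s ^ 2))
      ≤ ENNReal.ofReal ((18 / κ) ^ N) * B := by
    rw [Measure.addHaar_ball volume y (by positivity : (0 : ℝ) ≤ 4 * s ^ 2), ← mul_assoc,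
      ← ENNReal.ofReal_mul ha0]
    gcongr
    rw [finrank_euclideanSpace_fin, ha, ← mul_pow]
    refine pow_le_pow_left₀ (by positivity) ?_ N
    rcases eq_or_ne s 0 with h0 | h0
    · rw [h0]
      simp
      positivity
    · refine le_of_eq ?_
      field_simp
  calc ∫⁻ x in Ω, ‖kern ρ (fun x => u * (η x)⁻¹) x y‖ₑ
      ≤ ∫⁻ x in Ω, ((Metric.ball y (4 * s ^ 2)).indicator (fun _ => ENNReal.ofReal a) x
        + ENNReal.ofReal ((8 / κ) ^ N)) := setLIntegral_mono' ho.measurableSet hpt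
    _ ≤ ENNReal.ofReal a * volume (Metric.ball y (4 * s ^ 2))
        + ENNReal.ofReal ((8 / κ) ^ N) * volume Ω := by
      rw [lintegral_add_right _ measurable_const, setLIntegral_const]
      gcongr
      refine (setLIntegral_le_lintegral _ _).trans ?_
      rw [lintegral_indicator_const measurableSet_ball]
    _ ≤ ENNReal.ofReal ((18 / κ) ^ N) * B + ENNReal.ofReal ((8 / κ) ^ N) * volume Ω := by
      gcongr
    _ = ENNReal.ofReal ((18 / κ) ^ N * B.toReal + (8 / κ) ^ N * (volume Ω).toReal) := by
      rw [ENNReal.ofReal_add (by positivity) (by positivity), ENNReal.ofReal_mul (by positivity),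
        ENNReal.ofReal_mul (by positivity), ENNReal.ofReal_toReal hBtop,
        ENNReal.ofReal_toReal hΩtop]
    _ ≤ _ := ENNReal.ofReal_le_ofReal (by linarith)

/-- Multiplication by a cutoff. This replaces 1/η, smooth only on Ω, by a globally smooth function;
agreement near each point of K preserves derivatives as well. -/
theorem exists_contDiff_eventuallyEq {Ω K : Set (Eucl N)} (ho : IsOpen Ω) (hK : IsCompact K)
    (hKΩ : K ⊆ Ω) {r : Eucl N → ℝ} (hr : ContDiffOn ℝ ∞ r Ω) :
    ∃ q : Eucl N → ℝ, ContDiff ℝ ∞ q ∧ ∀ x ∈ K, q =ᶠ[nhds x] r := by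
  obtain ⟨L, hL, hKL, hLΩ⟩ := exists_compact_between hK ho hKΩ
  obtain ⟨χ, hχ1, hχ0, -⟩ := exists_contMDiffMap_one_nhds_of_subset_interior (n := ⊤)
    (modelWithCornersSelf ℝ (Eucl N)) hK.isClosed hKL
  have hχ : ContDiff ℝ ∞ χ := χ.contMDiff.contDiff
  refine ⟨fun x => χ x * r x, ?_, fun x hx => ?_⟩
  · rw [contDiff_iff_contDiffAt]
    intro x
    by_cases hx : x ∈ Ω
    · exact hχ.contDiffAt.mul (hr.contDiffAt (ho.mem_nhds hx))
    · have : (fun x => χ x * r x) =ᶠ[nhds x] fun _ => 0 := by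
        filter_upwards [hL.isClosed.isOpen_compl.mem_nhds fun h => hx (hLΩ h)] with z hz
        rw [hχ0 z hz, zero_mul]
      exact contDiffAt_const.congr_of_eventuallyEq this
  · filter_upwards [Filter.Eventually.filter_mono (nhds_le_nhdsSet hx) hχ1] with z hz
    rw [hz, one_mul]

/-- Substitute y = x - η(x)z. The right side sees only the values of g almost everywhere on Ω, so
the mollification is independent of the representative at every such x. -/
theorem mollify_eq_setIntegral_kern {Ω : Set (Eucl N)} {ρ : Eucl N → ℝ}
    (hρ : IsMollifierKernel ρ) (η : Eucl N → ℝ) (g : Eucl N → ℝ) {x : Eucl N} (hη : 0 < η x)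
    (hball : Metric.ball x (η x) ⊆ Ω) :
    mollify ρ η g x = (∫ y in Metric.ball (0 : Eucl N) 1, ρ y)⁻¹ *
      ∫ y in Ω, kern ρ (fun x => (η x)⁻¹) x y * g y := by
  have h1 : ∫ z in Metric.ball (0 : Eucl N) 1, ρ z * g (x - η x • z)
      = ∫ z, ρ z * g (x - η x • z) := by
    refine setIntegral_eq_integral_of_forall_compl_eq_zero fun z hz => ?_
    rw [(hρ.eq_zero_iff z).2 (by simpa using hz), zero_mul]
  have h2 : ∫ y in Ω, kern ρ (fun x => (η x)⁻¹) x y * g y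
      = ∫ y, kern ρ (fun x => (η x)⁻¹) x y * g y := by
    refine setIntegral_eq_integral_of_forall_compl_eq_zero fun y hy => ?_
    have hxy : η x ≤ ‖x - y‖ := by
      by_contra! h
      exact hy (hball (by rwa [Metric.mem_ball, dist_comm, dist_eq_norm]))
    have : ρ ((η x)⁻¹ • (x - y)) = 0 := by
      rw [hρ.eq_zero_iff, norm_smul, norm_inv, Real.norm_of_nonneg hη.le, inv_mul_eq_div,
        one_le_div hη]
      exact hxy
    rw [kern, this, mul_zero, zero_mul]
  have h3 := Measure.integral_comp_smul (volume : Measure (Eucl N))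
    (fun v => ρ ((η x)⁻¹ • v) * g (x - v)) (η x)
  have h4 := integral_sub_left_eq_self (fun v => ρ ((η x)⁻¹ • v) * g (x - v)) volume x
  simp only [sub_sub_cancel] at h4
  simp only [inv_smul_smul₀ hη.ne'] at h3
  rw [mollify, h1, h2, h3, ← h4, finrank_euclideanSpace_fin, abs_of_nonneg (by positivity),
    smul_eq_mul, ← integral_const_mul]
  simp only [kern, mul_assoc, inv_pow]

end VariableStep

/-! ### Schur's test in L¹ and Fubini for the adjoint. -/

namespace VariableStep

section Kernel

variable {α β : Type*} [MeasurableSpace α] [MeasurableSpace β] {μ : Measure α} {ν : Measure β}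
  [SFinite μ] [SFinite ν] {k : α → β → ℝ} {M : ℝ≥0∞} {f : β → ℝ}

/-- Tonelli: integrating in x first costs at most M for each y. -/
theorem lintegral_kernel_mul_le (hk : Measurable (Function.uncurry k))
    (hM : ∀ y, ∫⁻ x, ‖k x y‖ₑ ∂μ ≤ M) (hf : AEStronglyMeasurable f ν) :
    ∫⁻ p, ‖k p.1 p.2 * f p.2‖ₑ ∂(μ.prod ν) ≤ M * ∫⁻ y, ‖f y‖ₑ ∂ν := by
  have hm : AEStronglyMeasurable (fun p : α × β => k p.1 p.2 * f p.2) (μ.prod ν) :=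
    hk.aestronglyMeasurable.mul hf.comp_snd
  have hky (y : β) : Measurable fun x => k x y := hk.comp measurable_prodMk_right
  rw [lintegral_prod_symm _ hm.enorm]
  calc ∫⁻ y, ∫⁻ x, ‖k x y * f y‖ₑ ∂μ ∂ν ≤ ∫⁻ y, M * ‖f y‖ₑ ∂ν := by
        refine lintegral_mono fun y => ?_
        simp only [enorm_mul]
        rw [lintegral_mul_const _ (hky y).enorm]
        gcongr
        exact hM y
    _ = M * ∫⁻ y, ‖f y‖ₑ ∂ν := lintegral_const_mul'' _ hf.enorm

theorem integrable_kernel_mul (hk : Measurable (Function.uncurry k))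
    (hM : ∀ y, ∫⁻ x, ‖k x y‖ₑ ∂μ ≤ M) (hMtop : M ≠ ⊤) (hf : Integrable f ν) :
    Integrable (fun p : α × β => k p.1 p.2 * f p.2) (μ.prod ν) :=
  ⟨hk.aestronglyMeasurable.mul hf.aestronglyMeasurable.comp_snd,
    (lintegral_kernel_mul_le hk hM hf.aestronglyMeasurable).trans_lt
      (ENNReal.mul_lt_top hMtop.lt_top hf.hasFiniteIntegral)⟩

theorem lintegral_enorm_integral_kernel_mul_le (hk : Measurable (Function.uncurry k))
    (hM : ∀ y, ∫⁻ x, ‖k x y‖ₑ ∂μ ≤ M) (hf : AEStronglyMeasurable f ν) :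
    ∫⁻ x, ‖∫ y, k x y * f y ∂ν‖ₑ ∂μ ≤ M * ∫⁻ y, ‖f y‖ₑ ∂ν := by
  have hm : AEStronglyMeasurable (fun p : α × β => k p.1 p.2 * f p.2) (μ.prod ν) :=
    hk.aestronglyMeasurable.mul hf.comp_snd
  refine le_trans ?_ (lintegral_kernel_mul_le hk hM hf)
  rw [lintegral_prod _ hm.enorm]
  exact lintegral_mono fun x => enorm_integral_le_lintegral_enorm _

theorem integral_integral_kernel_mul (hk : Measurable (Function.uncurry k))
    (hM : ∀ y, ∫⁻ x, ‖k x y‖ₑ ∂μ ≤ M) (hMtop : M ≠ ⊤) (hf : Integrable f ν) {d : α → ℝ}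
    (hd : AEStronglyMeasurable d μ) {C : ℝ} (hC : ∀ x, ‖d x‖ ≤ C) :
    ∫ x, (∫ y, k x y * f y ∂ν) * d x ∂μ = ∫ y, f y * ∫ x, k x y * d x ∂μ ∂ν := by
  have hi : Integrable (fun p : α × β => k p.1 p.2 * f p.2 * d p.1) (μ.prod ν) :=
    (integrable_kernel_mul hk hM hMtop hf).mul_bdd hd.comp_fst
      (Filter.Eventually.of_forall fun p => hC p.1)
  simp_rw [← integral_mul_const, ← integral_const_mul]
  rw [integral_integral_swap hi]
  refine integral_congr_ae (Filter.Eventually.of_forall fun y => ?_)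
  refine integral_congr_ae (Filter.Eventually.of_forall fun x => ?_)
  simp only
  ring

end Kernel

/-! ### Duality: the variation bound. -/

variable {N : ℕ} {Ω : Set (Eucl N)} {ρ η : Eucl N → ℝ}

theorem divergence_eq_zero_of_notMem_tsupport {φ : Eucl N → Eucl N} {x : Eucl N}
    (hx : x ∉ tsupport φ) : divergence φ x = 0 := by
  have : fderiv ℝ φ x = 0 :=
    image_eq_zero_of_notMem_tsupport fun h => hx (tsupport_fderiv_subset ℝ h)
  simp [divergence, this]

theorem ofReal_integral_mul_divergence_le {f : Eucl N → ℝ} {Ψ : Eucl N → Eucl N} {C : ℝ}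
    (hC : 0 < C) (hΨ : ContDiff ℝ ∞ Ψ) (hc : HasCompactSupport Ψ) (hs : tsupport Ψ ⊆ Ω)
    (hb : ∀ x, ‖Ψ x‖ ≤ C) :
    ENNReal.ofReal (∫ x in Ω, f x * divergence Ψ x) ≤ ENNReal.ofReal C * variation Ω f := by
  have ht : IsTestField Ω fun x => C⁻¹ • Ψ x :=
    { smooth := hΨ.const_smul _
      compact := hc.smul_left (f := fun _ => C⁻¹)
      supp := (tsupport_smul_subset_right (fun _ => C⁻¹) Ψ).trans hs
      norm_le := fun x => by
        rw [norm_smul, norm_inv, Real.norm_of_nonneg hC.le, inv_mul_le_one₀ hC]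
        exact hb x }
  have h : ∫ x in Ω, f x * divergence Ψ x
      = C * ∫ x in Ω, f x * divergence (fun x => C⁻¹ • Ψ x) x := by
    rw [← integral_const_mul]
    refine integral_congr_ae (Filter.Eventually.of_forall fun x => ?_)
    simp only
    rw [divergence_const_smul_apply _ (hΨ.differentiable (by simp) x)]
    field_simp
  rw [h, ENNReal.ofReal_mul hC.le]
  gcongr
  exact le_iSup₂ (f := fun (φ : Eucl N → Eucl N) (_ : IsTestField Ω φ) =>
    ENNReal.ofReal (∫ x in Ω, f x * divergence φ x)) _ ht

theorem norm_dualField_le (hN : 1 ≤ N) (hρ : IsMollifierKernel ρ) {q : Eucl N → ℝ}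
    {φ : Eucl N → Eucl N} {x : Eucl N} {u G : ℝ} (hu : 1 ≤ u) (hη : 0 < η x)
    (hd : DifferentiableAt ℝ η x) (hq : q =ᶠ[nhds x] fun x => (η x)⁻¹)
    (hG : ‖fderiv ℝ η x‖ ≤ G) (hφ : ‖φ x‖ ≤ 1) (y : Eucl N) :
    ‖dualField ρ (fun x => u * q x) φ x y‖
      ≤ (1 + G) * ‖kern ρ (fun x => u * (η x)⁻¹) x y‖ := by
  have hqx : q x = (η x)⁻¹ := hq.self_of_nhds
  have hdq : HasFDerivAt (fun x => u * q x) (u • (-(η x ^ 2)⁻¹ • fderiv ℝ η x)) x :=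
    (((hasDerivAt_inv hη.ne').comp_hasFDerivAt x hd.hasFDerivAt).congr_of_eventuallyEq
      hq).const_mul u
  have hG0 : 0 ≤ G := (norm_nonneg _).trans hG
  -- Because D(1/η) = -Dη/η², the extra factor u is absorbed by the kernel, and the remaining vector
  -- no longer depends on u.
  have hrw : dualField ρ (fun x => u * q x) φ x y = kern ρ (fun x => u * (η x)⁻¹) x y •
      (φ x - (fderiv ℝ η x (φ x) * (η x)⁻¹) • (x - y)) := by
    rw [dualField, hdq.fderiv, kern]
    simp only [hqx]
    obtain ⟨n, rfl⟩ := Nat.exists_eq_add_of_le' hN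
    simp only [smul_apply, smul_eq_mul, Nat.add_sub_cancel]
    module
  rw [hrw, norm_smul, mul_comm]
  rcases le_or_gt (η x) ‖x - y‖ with hxy | hxy
  · have : ρ ((u * (η x)⁻¹) • (x - y)) = 0 := by
      rw [hρ.eq_zero_iff, norm_smul, Real.norm_of_nonneg (by positivity), mul_assoc]
      have : 1 ≤ (η x)⁻¹ * ‖x - y‖ := by
        rw [inv_mul_eq_div, one_le_div hη]
        exact hxy
      nlinarith
    simp [kern, this]
  gcongr
  refine (norm_sub_le _ _).trans (add_le_add hφ ?_)
  rw [norm_smul, norm_mul, norm_inv, Real.norm_of_nonneg hη.le, mul_assoc]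
  have h1 : ‖fderiv ℝ η x (φ x)‖ ≤ G :=
    ((fderiv ℝ η x).le_opNorm _).trans (by nlinarith [norm_nonneg (fderiv ℝ η x)])
  have h2 : (η x)⁻¹ * ‖x - y‖ ≤ 1 := by
    rw [inv_mul_eq_div, div_le_one hη]
    exact hxy.le
  calc ‖fderiv ℝ η x (φ x)‖ * ((η x)⁻¹ * ‖x - y‖) ≤ G * 1 := by gcongr
    _ = G := mul_one G

/-- Shortening the steps by a factor `u > 1` keeps the dual field compactly supported in `Ω`. -/
theorem exists_isCompact_dualField_eq_zero (hρ : IsMollifierKernel ρ) {q : Eucl N → ℝ}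
    {φ : Eucl N → Eucl N} {u : ℝ} (hu : 1 < u) (hc : HasCompactSupport φ)
    (hηc : ContinuousOn η (tsupport φ)) (hη : ∀ x ∈ tsupport φ, 0 < η x)
    (hball : ∀ x ∈ tsupport φ, Metric.ball x (η x) ⊆ Ω)
    (hq : ∀ x ∈ tsupport φ, q x = (η x)⁻¹) :
    ∃ L : Set (Eucl N), IsCompact L ∧ L ⊆ Ω ∧
      ∀ y ∉ L, ∀ x, dualField ρ (fun x => u * q x) φ x y = 0 := by
  have hu0 : 0 < u := by linarith
  -- Where the kernel is nonzero, y = x - η(x)z with |z| < 1/u. The closed ball of radius 1/u is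
  -- compact and, as u > 1, lies in the open unit ball.
  refine ⟨(fun p : Eucl N × Eucl N => p.1 - η p.1 • p.2) ''
    (tsupport φ ×ˢ Metric.closedBall 0 u⁻¹), ?_, ?_, ?_⟩
  · refine (hc.prod (isCompact_closedBall _ _)).image_of_continuousOn ?_
    exact continuousOn_fst.sub
      ((hηc.comp continuousOn_fst fun p hp => hp.1).smul continuousOn_snd)
  · rintro _ ⟨⟨x, z⟩, ⟨hx, hz⟩, rfl⟩
    refine hball x hx ?_
    have hz' : ‖z‖ ≤ u⁻¹ := by simpa using hz
    have hu1 : u⁻¹ < 1 := inv_lt_one_of_one_lt₀ hu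
    have := hη x hx
    simp only [Metric.mem_ball, dist_eq_norm, sub_sub_cancel_left, norm_neg, norm_smul,
      Real.norm_of_nonneg this.le]
    nlinarith
  · intro y hy x
    by_cases hx : x ∈ tsupport φ
    · have hηx := hη x hx
      have : ρ ((u * q x) • (x - y)) = 0 := by
        by_contra h
        rw [hρ.eq_zero_iff, not_le, hq x hx, mul_smul, norm_smul, Real.norm_of_nonneg hu0.le] at h
        refine hy ⟨(x, (η x)⁻¹ • (x - y)), ⟨hx, ?_⟩, ?_⟩
        · rw [mem_closedBall_zero_iff, ← one_div u, le_div_iff₀' hu0]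
          exact h.le
        · simp [smul_inv_smul₀ hηx.ne']
      simp [dualField, this]
    · simp [dualField, image_eq_zero_of_notMem_tsupport hx]

theorem continuous_integral_kern_mul (hρ : Continuous ρ) {q : Eucl N → ℝ} (hq : Continuous q)
    {d : Eucl N → ℝ} (hd : Continuous d) {K : Set (Eucl N)} (hK : IsCompact K)
    (h0 : ∀ x ∉ K, d x = 0) :
    Continuous fun p : ℝ × Eucl N => ∫ x, kern ρ (fun x => p.1 * q x) x p.2 * d x := by
  have h (p : ℝ × Eucl N) : ∫ x, kern ρ (fun x => p.1 * q x) x p.2 * d x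
      = ∫ x in K, kern ρ (fun x => p.1 * q x) x p.2 * d x :=
    (setIntegral_eq_integral_of_forall_compl_eq_zero fun x hx => by rw [h0 x hx, mul_zero]).symm
  simp_rw [h]
  refine continuous_parametric_integral_of_continuous ?_ hK
  unfold kern Function.uncurry
  fun_prop

/-- Testing the adjoint of the (unnormalised) mollifier against `div φ` is controlled by the total
variation. -/
theorem ofReal_integral_adjoint_divergence_le (hN : 1 ≤ N) (ho : IsOpen Ω)
    (hρ : IsMollifierKernel ρ) (hη : ContDiffOn ℝ ∞ η Ω) (hpos : ∀ x ∈ Ω, 0 < η x)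
    (hball : ∀ x ∈ Ω, Metric.ball x (η x) ⊆ Ω) {G : ℝ} (hG0 : 0 ≤ G)
    (hG : ∀ x ∈ Ω, ‖fderiv ℝ η x‖ ≤ G) {M : ℝ} (hM0 : 0 < M)
    (hM : ∀ u : ℝ, 1 ≤ u → u ≤ 2 → ∀ y : Eucl N,
      ∫⁻ x in Ω, ‖kern ρ (fun x => u * (η x)⁻¹) x y‖ₑ ≤ ENNReal.ofReal M)
    {f : Eucl N → ℝ} (hf : Integrable f (volume.restrict Ω)) {φ : Eucl N → Eucl N}
    (hφ : IsTestField Ω φ) :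
    ENNReal.ofReal (∫ y in Ω, f y * ∫ x in Ω, kern ρ (fun x => (η x)⁻¹) x y * divergence φ x)
      ≤ ENNReal.ofReal ((1 + G) * M) * variation Ω f := by
  obtain ⟨q, hq, hqη⟩ := exists_contDiff_eventuallyEq ho hφ.compact hφ.supp
    (hη.inv fun x hx => (hpos x hx).ne')
  have hqx (x) (hx : x ∈ tsupport φ) : q x = (η x)⁻¹ := (hqη x hx).self_of_nhds
  have hdiv0 (x) (hx : x ∉ tsupport φ) : divergence φ x = 0 :=
    divergence_eq_zero_of_notMem_tsupport hx
  set B : ℝ → Eucl N → ℝ := fun u y => ∫ x, kern ρ (fun x => u * q x) x y * divergence φ x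
    with hBdef
  have hBc : Continuous fun p : ℝ × Eucl N => B p.1 p.2 :=
    continuous_integral_kern_mul hρ.smooth.continuous hq.continuous (continuous_divergence hφ)
      hφ.compact hdiv0
  have hBΩ (u : ℝ) (y : Eucl N) :
      B u y = ∫ x in Ω, kern ρ (fun x => u * (η x)⁻¹) x y * divergence φ x := by
    rw [hBdef]
    simp only
    rw [← setIntegral_eq_integral_of_forall_compl_eq_zero (s := Ω)
      fun x hx => by rw [hdiv0 x fun h => hx (hφ.supp h), mul_zero]]
    refine integral_congr_ae (Filter.Eventually.of_forall fun x => ?_)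
    by_cases hx : x ∈ tsupport φ
    · simp only [kern, hqx x hx]
    · simp only [hdiv0 x hx, mul_zero]
  have hnorm (y : Eucl N) (C u : ℝ) (hC : 0 ≤ C) (h1 : 1 ≤ u) (h2 : u ≤ 2)
      {F : Type} [NormedAddCommGroup F] [NormedSpace ℝ F] (v : Eucl N → F)
      (hv : ∀ x ∈ Ω, ‖v x‖ ≤ C * ‖kern ρ (fun x => u * (η x)⁻¹) x y‖) :
      ‖∫ x in Ω, v x‖ ≤ C * M := by
    have : ‖∫ x in Ω, v x‖ₑ ≤ ENNReal.ofReal (C * M) := by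
      refine (enorm_integral_le_lintegral_enorm _).trans ?_
      rw [ENNReal.ofReal_mul hC]
      calc ∫⁻ x in Ω, ‖v x‖ₑ
          ≤ ∫⁻ x in Ω, ENNReal.ofReal C * ‖kern ρ (fun x => u * (η x)⁻¹) x y‖ₑ := by
            refine setLIntegral_mono' ho.measurableSet fun x hx => ?_
            rw [← ofReal_norm, ← ofReal_norm, ← ENNReal.ofReal_mul hC]
            exact ENNReal.ofReal_le_ofReal (hv x hx)
        _ = ENNReal.ofReal C * ∫⁻ x in Ω, ‖kern ρ (fun x => u * (η x)⁻¹) x y‖ₑ :=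
            lintegral_const_mul' _ _ ENNReal.ofReal_ne_top
        _ ≤ _ := by
            gcongr
            exact hM u h1 h2 y
    rw [← ofReal_norm] at this
    exact (ENNReal.ofReal_le_ofReal_iff (by positivity)).1 this
  obtain ⟨C, hC⟩ := exists_bound_divergence hφ
  have hC0 : 0 ≤ C := (norm_nonneg _).trans (hC 0)
  have hBb (u : ℝ) (h1 : 1 ≤ u) (h2 : u ≤ 2) (y : Eucl N) : ‖B u y‖ ≤ C * M := by
    rw [hBΩ]
    refine hnorm y C u hC0 h1 h2 _ fun x _ => ?_
    rw [norm_mul, mul_comm]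
    gcongr
    exact hC x
  -- For u > 1 the integrated dual field is admissible after rescaling by (1+G)M.
  have hstep (u : ℝ) (h1 : 1 < u) (h2 : u ≤ 2) :
      ENNReal.ofReal (∫ y in Ω, f y * B u y) ≤ ENNReal.ofReal ((1 + G) * M) * variation Ω f := by
    have huq : ContDiff ℝ ∞ fun x => u * q x := contDiff_const.mul hq
    have hV := contDiff_uncurry_dualField hρ.smooth huq hφ.smooth
    have h0 (x) (hx : x ∉ tsupport φ) (y : Eucl N) : dualField ρ (fun x => u * q x) φ x y = 0 := by
      simp [dualField, image_eq_zero_of_notMem_tsupport hx]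
    obtain ⟨L, hL, hLΩ, hL0⟩ := exists_isCompact_dualField_eq_zero (Ω := Ω) hρ h1 hφ.compact
      (hη.continuousOn.mono hφ.supp) (fun x hx => hpos x (hφ.supp hx))
      (fun x hx => hball x (hφ.supp hx)) hqx
    have hΨ0 (y) (hy : y ∉ L) : ∫ x, dualField ρ (fun x => u * q x) φ x y = 0 := by
      simp [hL0 y hy]
    have hBdiv (y : Eucl N) :
        B u y = divergence (fun y => ∫ x, dualField ρ (fun x => u * q x) φ x y) y :=
      (divergence_integral_dualField hN hρ.smooth huq hφ.smooth hφ.compact y).symm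
    simp_rw [hBdiv]
    refine ofReal_integral_mul_divergence_le (by positivity)
      (contDiff_integral_param hV hφ.compact h0) (HasCompactSupport.intro hL hΨ0)
      ((closure_minimal (fun y hy => ?_) hL.isClosed).trans hLΩ) fun y => ?_
    · by_contra h
      exact hy (hΨ0 y h)
    · rw [← setIntegral_eq_integral_of_forall_compl_eq_zero (s := Ω)
        fun x hx => h0 x (fun h => hx (hφ.supp h)) y]
      refine hnorm y (1 + G) u (by positivity) h1.le h2 _ fun x hx => ?_
      by_cases hxK : x ∈ tsupport φ
      · exact norm_dualField_le hN hρ h1.le (hpos x hx)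
          ((hη.contDiffAt (ho.mem_nhds hx)).differentiableAt (by simp)) (hqη x hxK) (hG x hx)
          (hφ.norm_le x) y
      · rw [h0 x hxK, norm_zero]
        positivity
  -- Dominated by |f| times the bound C M on the inner integral, which is uniform for 1 < u ≤ 2.
  have hlim : Filter.Tendsto (fun u => ∫ y in Ω, f y * B u y) (nhdsWithin 1 (Set.Ioi 1))
      (nhds (∫ y in Ω, f y * B 1 y)) := by
    refine tendsto_integral_filter_of_dominated_convergence (fun y => ‖f y‖ * (C * M))
      (Filter.Eventually.of_forall fun u => hf.aestronglyMeasurable.mul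
        (Continuous.aestronglyMeasurable (hBc.comp (continuous_const.prodMk continuous_id))))
      ?_ (hf.norm.mul_const _) (Filter.Eventually.of_forall fun y => ?_)
    · filter_upwards [Ioc_mem_nhdsGT (one_lt_two : (1 : ℝ) < 2)] with u hu
      refine Filter.Eventually.of_forall fun y => ?_
      rw [norm_mul]
      gcongr
      exact hBb u hu.1.le hu.2 y
    · have : Continuous fun u => f y * B u y :=
        continuous_const.mul (hBc.comp (continuous_id.prodMk continuous_const))
      exact (this.tendsto 1).mono_left nhdsWithin_le_nhds
  have hB1 (y : Eucl N) :
      ∫ x in Ω, kern ρ (fun x => (η x)⁻¹) x y * divergence φ x = B 1 y := by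
    rw [hBΩ]
    simp only [one_mul]
  simp_rw [hB1]
  refine le_of_tendsto ((ENNReal.continuous_ofReal.tendsto _).comp hlim) ?_
  filter_upwards [Ioc_mem_nhdsGT (one_lt_two : (1 : ℝ) < 2)] with u hu
  exact hstep u hu.1 hu.2

end VariableStep

/-! ### From estimates on functions to a bounded operator on BV. -/

namespace VariableStep

variable {N : ℕ} {Ω : Set (Eucl N)}

/-- A linear map on integrable functions that respects a.e. equality, does not increase the
`L¹`-norm by more than a factor `A` and the total variation by more than a factor `B`, induces
a bounded operator on `BV(Ω)`. -/
theorem exists_continuousLinearMap_BV (S : (Eucl N → ℝ) → Eucl N → ℝ)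
    (hcongr : ∀ f g, f =ᵐ[volume.restrict Ω] g → S f =ᵐ[volume.restrict Ω] S g)
    (hadd : ∀ f g, Integrable f (volume.restrict Ω) → Integrable g (volume.restrict Ω) →
      S (f + g) =ᵐ[volume.restrict Ω] S f + S g)
    (hsmul : ∀ (c : ℝ) f, S (c • f) =ᵐ[volume.restrict Ω] c • S f)
    (hint : ∀ f, Integrable f (volume.restrict Ω) → Integrable (S f) (volume.restrict Ω))
    {A B : ℝ} (hA0 : 0 ≤ A) (hB0 : 0 ≤ B)
    (hA : ∀ f, Integrable f (volume.restrict Ω) →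
      ∫⁻ x in Ω, ‖S f x‖ₑ ≤ ENNReal.ofReal A * ∫⁻ x in Ω, ‖f x‖ₑ)
    (hB : ∀ f, Integrable f (volume.restrict Ω) →
      variation Ω (S f) ≤ ENNReal.ofReal B * variation Ω f) :
    ∃ T : BV Ω →L[ℝ] BV Ω, ∀ f : BV Ω,
      (BV.toL1 (T f) : Eucl N → ℝ) =ᵐ[volume.restrict Ω] S (BV.toL1 f) := by
  have hfi (f : BV Ω) : Integrable (BV.toL1 f) (volume.restrict Ω) := L1.integrable_coeFn _
  let L (f : BV Ω) : Lp ℝ 1 (volume.restrict Ω) := (hint _ (hfi f)).toL1 _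
  have hL (f : BV Ω) : (L f : Eucl N → ℝ) =ᵐ[volume.restrict Ω] S (BV.toL1 f) :=
    Integrable.coeFn_toL1 _
  have hvar (f : BV Ω) : variation Ω (L f) ≤ ENNReal.ofReal B * variation Ω (BV.toL1 f) := by
    rw [variation_congr (hL f)]
    exact hB _ (hfi f)
  have hnorm (f : BV Ω) : ‖L f‖ ≤ A * ‖BV.toL1 f‖ := by
    have h := hA _ (hfi f)
    rw [← ENNReal.ofReal_le_ofReal_iff (by positivity), ENNReal.ofReal_mul hA0, ofReal_norm,
      ofReal_norm, Lp.enorm_def, Lp.enorm_def, eLpNorm_one_eq_lintegral_enorm,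
      eLpNorm_one_eq_lintegral_enorm]
    refine le_trans (le_of_eq ?_) h
    refine lintegral_congr_ae ?_
    filter_upwards [hL f] with x hx
    rw [hx]
  let T₀ (f : BV Ω) : BV Ω := ⟨L f, (hvar f).trans_lt
    (ENNReal.mul_lt_top ENNReal.ofReal_lt_top (BV.variation_lt_top f))⟩
  have hT₀ (f : BV Ω) : BV.toL1 (T₀ f) = L f := rfl
  let T₁ : BV Ω →ₗ[ℝ] BV Ω :=
    { toFun := T₀
      map_add' := fun f g => by
        apply BV.toL1_injective
        rw [map_add, hT₀, hT₀, hT₀]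
        refine Lp.ext ?_
        refine (hL _).trans (.trans ?_ (Lp.coeFn_add _ _).symm)
        have h1 : (BV.toL1 (f + g) : Eucl N → ℝ) =ᵐ[volume.restrict Ω]
            (BV.toL1 f : Eucl N → ℝ) + (BV.toL1 g : Eucl N → ℝ) := by
          rw [map_add]
          exact Lp.coeFn_add _ _
        exact (hcongr _ _ h1).trans ((hadd _ _ (hfi f) (hfi g)).trans ((hL f).symm.add (hL g).symm))
      map_smul' := fun c f => by
        apply BV.toL1_injective
        rw [RingHom.id_apply, map_smul, hT₀, hT₀]
        refine Lp.ext ?_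
        refine (hL _).trans (.trans ?_ (Lp.coeFn_smul _ _).symm)
        have h1 : (BV.toL1 (c • f) : Eucl N → ℝ) =ᵐ[volume.restrict Ω]
            c • (BV.toL1 f : Eucl N → ℝ) := by
          rw [map_smul]
          exact Lp.coeFn_smul _ _
        exact (hcongr _ _ h1).trans ((hsmul _ _).trans ((hL f).symm.const_smul c)) }
  refine ⟨T₁.mkContinuous (max A B) fun f => ?_, hL⟩
  have hv : (variation Ω (L f)).toReal ≤ B * (variation Ω (BV.toL1 f)).toReal := by
    have := ENNReal.toReal_mono
      (ENNReal.mul_lt_top ENNReal.ofReal_lt_top (BV.variation_lt_top f)).ne (hvar f)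
    rwa [ENNReal.toReal_mul, ENNReal.toReal_ofReal hB0] at this
  change ‖T₀ f‖ ≤ _
  rw [BV.norm_def, BV.norm_def, hT₀, mul_add]
  refine add_le_add ((hnorm f).trans ?_) (hv.trans ?_)
  · gcongr
    exact le_max_left _ _
  · gcongr
    exact le_max_right _ _

theorem mollify_kernel_bounds {ρ η : Eucl N → ℝ} (hN : 1 ≤ N) (ho : IsOpen Ω)
    (hρ : IsMollifierKernel ρ) (hη : ContDiffOn ℝ ∞ η Ω) (hpos : ∀ x ∈ Ω, 0 < η x)
    (hball : ∀ x ∈ Ω, Metric.ball x (η x) ⊆ Ω) {G : ℝ} (hG0 : 0 ≤ G)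
    (hG : ∀ x ∈ Ω, ‖fderiv ℝ η x‖ ≤ G) {M : ℝ} (hM0 : 0 < M)
    (hM : ∀ u : ℝ, 1 ≤ u → u ≤ 2 → ∀ y : Eucl N,
      ∫⁻ x in Ω, ‖kern ρ (fun x => u * (η x)⁻¹) x y‖ₑ ≤ ENNReal.ofReal M)
    {f : Eucl N → ℝ} (hf : Integrable f (volume.restrict Ω)) :
    (∀ᵐ x ∂volume.restrict Ω,
      Integrable (fun y => kern ρ (fun x => (η x)⁻¹) x y * f y) (volume.restrict Ω)) ∧
    Integrable (fun x => ∫ y in Ω, kern ρ (fun x => (η x)⁻¹) x y * f y) (volume.restrict Ω) ∧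
    ∫⁻ x in Ω, ‖∫ y in Ω, kern ρ (fun x => (η x)⁻¹) x y * f y‖ₑ
      ≤ ENNReal.ofReal M * ∫⁻ x in Ω, ‖f x‖ₑ ∧
    variation Ω (fun x => ∫ y in Ω, kern ρ (fun x => (η x)⁻¹) x y * f y)
      ≤ ENNReal.ofReal ((1 + G) * M) * variation Ω f := by
  -- Nothing is known about η outside Ω, not even measurability; extension by zero makes the kernel
  -- measurable on the whole product.
  set q : Eucl N → ℝ := Ω.indicator fun x => (η x)⁻¹ with hqdef
  have hqΩ (x) (hx : x ∈ Ω) (y : Eucl N) :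
      kern ρ (fun x => (η x)⁻¹) x y = kern ρ q x y := by
    simp only [kern, hqdef, Set.indicator_of_mem hx]
  have hae : ∀ᵐ x ∂volume.restrict Ω, x ∈ Ω := ae_restrict_mem ho.measurableSet
  have hqm : Measurable q := by
    have h : ContinuousOn (fun x => (η x)⁻¹) Ω :=
      hη.continuousOn.inv₀ fun x hx => (hpos x hx).ne'
    classical
    rw [hqdef, ← Set.piecewise_eq_indicator]
    exact h.measurable_piecewise continuousOn_const ho.measurableSet
  have hkm : Measurable (Function.uncurry (kern ρ q)) := by
    have hq1 : Measurable fun p : Eucl N × Eucl N => q p.1 := hqm.comp measurable_fst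
    exact (hq1.pow_const N).mul (hρ.smooth.continuous.measurable.comp
      (hq1.smul (measurable_fst.sub measurable_snd)))
  have hkM (y : Eucl N) : ∫⁻ x in Ω, ‖kern ρ q x y‖ₑ ≤ ENNReal.ofReal M := by
    refine le_trans (le_of_eq ?_) (hM 1 le_rfl one_le_two y)
    refine setLIntegral_congr_fun ho.measurableSet fun x hx => ?_
    simp only [one_mul]
    rw [hqΩ x hx]
  have hSe : (fun x => ∫ y in Ω, kern ρ (fun x => (η x)⁻¹) x y * f y)
      =ᵐ[volume.restrict Ω] fun x => ∫ y in Ω, kern ρ q x y * f y := by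
    filter_upwards [hae] with x hx
    simp_rw [hqΩ x hx]
  have hi := integrable_kernel_mul hkm hkM ENNReal.ofReal_ne_top hf
  refine ⟨?_, hi.integral_prod_left.congr hSe.symm, ?_, ?_⟩
  · filter_upwards [hi.prod_right_ae, hae] with x hx hxΩ
    simp_rw [hqΩ x hxΩ]
    exact hx
  · refine le_trans (le_of_eq (lintegral_congr_ae ?_))
      (lintegral_enorm_integral_kernel_mul_le hkm hkM hf.aestronglyMeasurable)
    filter_upwards [hSe] with x hx
    rw [hx]
  · rw [variation_congr hSe]
    refine iSup₂_le fun φ hφ => ?_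
    obtain ⟨C, hC⟩ := exists_bound_divergence hφ
    rw [integral_integral_kernel_mul hkm hkM ENNReal.ofReal_ne_top hf
      (continuous_divergence hφ).aestronglyMeasurable hC]
    refine le_trans (le_of_eq ?_)
      (ofReal_integral_adjoint_divergence_le hN ho hρ hη hpos hball hG0 hG hM0 hM hf hφ)
    congr 1
    refine integral_congr_ae (Filter.Eventually.of_forall fun y => ?_)
    simp only
    congr 1
    refine setIntegral_congr_fun ho.measurableSet fun x hx => ?_
    rw [hqΩ x hx]

end VariableStep

theorem proposition5p8 {N : ℕ} (hN : 1 ≤ N)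
    (Ω : Set (VariableStep.Eucl N)) (hΩ : IsOpen Ω) (hΩb : Bornology.IsBounded Ω)
    (ρ : VariableStep.Eucl N → ℝ) (hρ : VariableStep.IsMollifierKernel ρ)
    (η : VariableStep.Eucl N → ℝ) (hη : ContDiffOn ℝ ∞ η Ω)
    (hη_grad : ∃ G : ℝ, ∀ x ∈ Ω, ‖fderiv ℝ η x‖ ≤ G)
    (hη_dist : ∀ x ∈ Ω, η x ≤ VariableStep.bdryDist Ω x)
    (κ : ℝ) (hκ : 0 < κ)
    (hη_lower : ∀ x ∈ Ω, κ * VariableStep.bdryDist Ω x ^ 2 ≤ η x)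
    (hη_upper : ∀ x ∈ Ω, η x ≤ VariableStep.bdryDist Ω x ^ 2) :
    ∃ T : VariableStep.BV Ω →L[ℝ] VariableStep.BV Ω,
      ∀ (f : VariableStep.BV Ω) (g : VariableStep.Eucl N → ℝ),
        g =ᵐ[volume.restrict Ω] (VariableStep.BV.toL1 f) →
          (VariableStep.BV.toL1 (T f) : VariableStep.Eucl N → ℝ)
            =ᵐ[volume.restrict Ω] VariableStep.mollify ρ η g := by
  open VariableStep in
  obtain ⟨G, hG⟩ := hη_grad
  -- If Ω is empty, G may be negative.
  have hG' : ∀ x ∈ Ω, ‖fderiv ℝ η x‖ ≤ max G 0 := fun x hx => (hG x hx).trans (le_max_left _ _)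
  obtain ⟨M, hM0, hM⟩ := exists_lintegral_kern_le hN hΩ hΩb hρ hκ hη_lower hη_upper
  have hpos : ∀ x ∈ Ω, 0 < η x := fun x hx =>
    lt_of_lt_of_le (mul_pos hκ (pow_pos (bdryDist_pos hN hΩ hΩb hx) 2)) (hη_lower x hx)
  have hball : ∀ x ∈ Ω, Metric.ball x (η x) ⊆ Ω := fun x hx =>
    (Metric.ball_subset_ball (hη_dist x hx)).trans (ball_bdryDist_subset hN hΩb hx)
  set c : ℝ := (∫ y in Metric.ball (0 : Eucl N) 1, ρ y)⁻¹ with hc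
  -- In kernel form the operator takes equal values everywhere on a.e. equal functions; it agrees
  -- with `mollify` on Ω.
  let S (g : Eucl N → ℝ) (x : Eucl N) : ℝ :=
    c * ∫ y in Ω, kern ρ (fun x => (η x)⁻¹) x y * g y
  have hS {f g : Eucl N → ℝ} (h : f =ᵐ[volume.restrict Ω] g) : S f = S g := by
    funext x
    simp only [S]
    congr 1
    refine integral_congr_ae ?_
    filter_upwards [h] with y hy
    rw [hy]
  have hb {f : Eucl N → ℝ} (hf : Integrable f (volume.restrict Ω)) :=
    mollify_kernel_bounds hN hΩ hρ hη hpos hball (le_max_right G 0) hG' hM0 hM hf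
  obtain ⟨T, hT⟩ := exists_continuousLinearMap_BV (Ω := Ω) S (A := |c| * M)
    (B := |c| * ((1 + max G 0) * M))
    (fun f g h => by rw [hS h])
    (fun f g hf hg => by
      filter_upwards [(hb hf).1, (hb hg).1] with x h1 h2
      simp only [S, Pi.add_apply, mul_add]
      rw [integral_add h1 h2, mul_add])
    (fun a f => Filter.Eventually.of_forall fun x => by
      simp only [S, Pi.smul_apply, smul_eq_mul, mul_left_comm _ a]
      rw [integral_const_mul]
      ring)
    (fun f hf => (hb hf).2.1.const_mul c) (by positivity) (by positivity)
    (fun f hf => by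
      simp only [S, enorm_mul]
      rw [lintegral_const_mul' _ _ enorm_ne_top, ENNReal.ofReal_mul (abs_nonneg c), mul_assoc,
        ← Real.norm_eq_abs, ofReal_norm]
      gcongr
      exact (hb hf).2.2.1)
    (fun f hf => by
      rw [ENNReal.ofReal_mul (abs_nonneg c), mul_assoc]
      refine (variation_smul_le c _).trans ?_
      gcongr
      exact (hb hf).2.2.2)
  refine ⟨T, fun f g hg => (hT f).trans ?_⟩
  rw [← hS hg]
  filter_upwards [ae_restrict_mem hΩ.measurableSet] with x hx
  exact (mollify_eq_setIntegral_kern hρ η g (hpos x hx) (hball x hx)).symm
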